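/- Let $\mathcal Y$ be a Polish space with its Borel $\sigma$-algebra, $H$ a probability measure on $\mathcal Y$, and $0<q<\theta$ real numbers. A gamma process with shape $\theta H$ is a random finite measure $\mu$ on $\mathcal Y$ whose law $\mathcal G(d\mu\mid\theta H)$ is characterized by $$\int e^{-\mu(g)}\,\mathcal G(d\mu\mid\theta H)=\exp\Bigl(-\int_{\mathcal Y}\log[1+g(y)]\,\theta H(dy)\Bigr)$$ for all measurable $g\ge 0$ with $\int_{\mathcal Y}\log[1+g(y)]\,\theta H(dy)<\infty$, where $\mu(g)=\int g\,d\mu$. The beta–gamma process $\mathcal{BG}(\theta H,\theta-q)$ is the random measure with law $$\mathcal{BG}(d\mu\mid\theta H,\theta-q)=\frac{\Gamma(\theta)}{\Gamma(q)}\,T^{-(\theta-q)}\,\mathcal G(d\mu\mid\theta H),\qquad T=\mu(\mathcal Y).$$ Write $\mathcal B(du\mid a,b)=\frac{\Gamma(a+b)}{\Gamma(a)\Gamma(b)}u^{a-1}(1-u)^{b-1}du$ on $(0,1)$ for the beta distribution and $\gamma(dv\mid\tau,r)=\frac{\Gamma(\tau)}{\Gamma(r)\Gamma(\tau-r)}v^{r-1}(1+v)^{-\tau}dv$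 on $(0,\infty)$, $0<r<\tau$, for the gamma–gamma distribution. **Proposition 3.1.** For every measurable $g\ge 0$ with $\int_{\mathcal Y}\log[1+g(y)]\,\theta H(dy)<\infty$, $$\int e^{-\mu(g)}\,\mathcal{BG}(d\mu\mid\theta H,\theta-q)=\int_0^1 e^{-\int_{\mathcal Y}\log[1+ug(y)]\,\theta H(dy)}\,\mathcal B(du\mid q,\theta-q).$$ Under the transformation $v=u/(1-u)$ the law $\mathcal B(du\mid q,\theta-q)$ becomes $\gamma(dv\mid\theta,q)$, and the Laplace functional also equals $$\int_0^\infty e^{-\int_{\mathcal Y}\log[1+\frac{v}{1+v}g(y)]\,\theta H(dy)}\,\gamma(dv\mid\theta,q).$$ Likewise, under $v=(1-u)/u$ the law $\mathcal B(du\mid q,\theta-q)$ becomes $\gamma(dv\mid\theta,\theta-q)$, and the Laplace functional also equals $$\int_0^\infty e^{-\int_{\mathcal Y}\log[1+\frac{1}{1+v}g(y)]\,\theta H(dy)}\,\gamma(dv\mid\theta,\theta-q).$$ -/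

import Mathlib

open MeasureTheory ProbabilityTheory
open scoped ENNReal NNReal

/-- The Laplace functional `g ↦ ∫ exp(-μ(g)) Q(dμ)` of a law `Q` on the measures on `Y` (with the
`σ`-algebra generated by the evaluations), where `μ(g) = ∫ g dμ ∈ [0, ∞]` and `exp(-∞) = 0`. -/
noncomputable def laplaceFunctional {Y : Type*} [MeasurableSpace Y] (Q : Measure (Measure Y))
    (g : Y → ℝ≥0) : ℝ≥0∞ :=
  ∫⁻ μ, EReal.exp (-((∫⁻ y, (g y : ℝ≥0∞) ∂μ : ℝ≥0∞) : EReal)) ∂Q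

/-- `G` is the law of a gamma process with (finite) shape measure `α`: a probability law on the
finite measures on `Y` with `∫ exp(-μ(g)) G(dμ) = exp(-∫ log(1 + g) dα)` for all measurable
`g ≥ 0` with `∫ log(1 + g) dα < ∞`. -/
structure IsGammaProcessLaw {Y : Type*} [MeasurableSpace Y] (G : Measure (Measure Y))
    (α : Measure Y) : Prop where
  isProbabilityMeasure : IsProbabilityMeasure G
  ae_isFiniteMeasure : ∀ᵐ μ ∂G, IsFiniteMeasure μ
  laplace : ∀ g : Y → ℝ≥0, Measurable g → Integrable (fun y => Real.log (1 + (g y : ℝ))) α →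
    laplaceFunctional G g = ENNReal.ofReal (Real.exp (-∫ y, Real.log (1 + (g y : ℝ)) ∂α))

/-- `B` is the beta-gamma law `BG(dμ | θH, θ - q) = Γ(θ)/Γ(q) · T ^ (-(θ - q)) G(dμ | θH)`, where
`T = μ(Y)` is the total mass and `G(dμ | θH)` is the gamma process law with shape `θH`. -/
def IsBetaGammaProcessLaw {Y : Type*} [MeasurableSpace Y] (B : Measure (Measure Y))
    (H : Measure Y) (θ q : ℝ) : Prop :=
  ∃ G : Measure (Measure Y), IsGammaProcessLaw G (ENNReal.ofReal θ • H) ∧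
    B = ENNReal.ofReal (Real.Gamma θ / Real.Gamma q) •
      G.withDensity (fun μ => (μ Set.univ) ^ (-(θ - q)))

/-- The gamma-gamma distribution `γ(dv | τ, q)` on `(0, ∞)`, with density
`Γ(τ) / (Γ(q) Γ(τ - q)) · v ^ (q - 1) (1 + v) ^ (-τ)`, for `0 < q < τ`. -/
noncomputable def gammaGammaMeasure (τ q : ℝ) : Measure ℝ :=
  (volume.restrict (Set.Ioi 0)).withDensity fun v => ENNReal.ofReal
    (Real.Gamma τ / (Real.Gamma q * Real.Gamma (τ - q)) * v ^ (q - 1) * (1 + v) ^ (-τ))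

/-! The total mass `T` enters the beta-gamma law only through `T ^ (-r)` with `r = θ - q`, and
`Γ(r) T ^ (-r) = ∫₀^∞ s ^ (r - 1) exp(-s T) ds`. Since `exp(-s T) exp(-μ(g)) = exp(-μ(g + s))`,
Tonelli's theorem turns the Laplace functional of the beta-gamma law at `g` into a mixture over `s`
of the gamma Laplace functionals at `g + s`
(`IsGammaProcessLaw.lintegral_rpow_neg_mul_exp_neg`). The factorization
`1 + s + g = (1 + s) (1 + g / (1 + s))` splits off the factor `(1 + s) ^ (-θ)`, which together with
`s ^ (r - 1)` makes up the gamma-gamma density with parameters `θ` and `θ - q`. This is the last of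
the three forms of the Laplace functional. The representation of `T ^ (-r)` also holds at `T = 0`,
where both sides are infinite, so it is not needed that the total mass is almost surely positive.

The other two forms follow from the two changes of variables `betaMeasure_map_div_one_sub` and
`betaMeasure_map_one_sub_div`. The first is an instance of the one-dimensional change of variables
formula for densities, `map_withDensity_restrict`; the second follows from the first by the
reflection `u ↦ 1 - u`, which exchanges the two parameters of the beta distribution. -/

/-! ### The exponential of an extended nonnegative number -/

lemma exp_neg_coe_add (a b : ℝ≥0∞) :
    EReal.exp (-((a + b : ℝ≥0∞) : EReal)) =
      EReal.exp (-(a : EReal)) * EReal.exp (-(b : EReal)) := by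
  have h (c : ℝ≥0∞) : EReal.exp (c : EReal) ≠ 0 := by simp
  rw [EReal.exp_neg, EReal.exp_neg, EReal.exp_neg, EReal.coe_ennreal_add, EReal.exp_add,
    ENNReal.mul_inv (.inl (h a)) (.inr (h b))]

lemma exp_neg_coe_ofReal {x : ℝ} (hx : 0 ≤ x) :
    EReal.exp (-((ENNReal.ofReal x : ℝ≥0∞) : EReal)) = ENNReal.ofReal (Real.exp (-x)) := by
  rw [EReal.coe_ennreal_ofReal, max_eq_left hx, ← EReal.coe_neg, EReal.exp_coe]

/-- The gamma integral, for an arbitrary `T ∈ [0, ∞]`: at `T = 0` both sides are infinite, at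
`T = ∞` both vanish. -/
lemma lintegral_rpow_mul_exp_neg_mul {r : ℝ} (hr : 0 < r) (T : ℝ≥0∞) :
    ∫⁻ s in Set.Ioi (0 : ℝ), ENNReal.ofReal (s ^ (r - 1)) *
      EReal.exp (-((ENNReal.ofReal s * T : ℝ≥0∞) : EReal)) =
      ENNReal.ofReal (Real.Gamma r) * T ^ (-r) := by
  have hΓ : 0 < Real.Gamma r := Real.Gamma_pos_of_pos hr
  rcases eq_or_ne T ⊤ with rfl | hT
  · rw [ENNReal.top_rpow_of_neg (by linarith), mul_zero]
    refine setLIntegral_eq_zero measurableSet_Ioi fun s hs => ?_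
    have : ENNReal.ofReal s ≠ 0 := by simpa using hs
    simp [ENNReal.mul_top this]
  rcases eq_or_ne T 0 with rfl | hT0
  · rw [ENNReal.zero_rpow_of_neg (by linarith), ENNReal.mul_top (by simpa using hΓ)]
    simp only [mul_zero, EReal.coe_ennreal_zero, neg_zero, EReal.exp_zero, mul_one]
    by_contra h
    refine not_integrableOn_Ioi_rpow (r - 1) ⟨by fun_prop, ?_⟩
    rw [hasFiniteIntegral_iff_ofReal]
    · exact lt_top_iff_ne_top.2 h
    · exact ae_restrict_of_forall_mem measurableSet_Ioi fun s hs =>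
        Real.rpow_nonneg (le_of_lt hs) _
  · have ht : 0 < T.toReal := ENNReal.toReal_pos hT0 hT
    have hI := Real.integral_rpow_mul_exp_neg_mul_Ioi hr ht
    have hint : IntegrableOn (fun s : ℝ => s ^ (r - 1) * Real.exp (-(T.toReal * s)))
        (Set.Ioi 0) := by
      by_contra h
      rw [integral_undef h] at hI
      exact absurd hI (by positivity)
    calc _ = ∫⁻ s in Set.Ioi (0 : ℝ),
          ENNReal.ofReal (s ^ (r - 1) * Real.exp (-(T.toReal * s))) := by
          refine setLIntegral_congr_fun measurableSet_Ioi fun s hs => ?_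
          have hs' : (0 : ℝ) ≤ s := le_of_lt hs
          have : ENNReal.ofReal s * T = ENNReal.ofReal (T.toReal * s) := by
            rw [mul_comm, ENNReal.ofReal_mul ht.le, ENNReal.ofReal_toReal hT]
          simp only [this]
          rw [exp_neg_coe_ofReal (by positivity), ← ENNReal.ofReal_mul (by positivity)]
      _ = ENNReal.ofReal ((1 / T.toReal) ^ r * Real.Gamma r) := by
          rw [← hI, ofReal_integral_eq_lintegral_ofReal hint]
          exact ae_restrict_of_forall_mem measurableSet_Ioi fun s hs =>
            mul_nonneg (Real.rpow_nonneg (le_of_lt hs) _) (Real.exp_nonneg _)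
      _ = _ := by
          rw [mul_comm, ENNReal.ofReal_mul hΓ.le, one_div, ← Real.rpow_neg_eq_inv_rpow,
            ← ENNReal.ofReal_rpow_of_pos ht, ENNReal.ofReal_toReal hT]

/-! ### Negative moments of the total mass of a gamma process -/

lemma log_one_add_add {s : ℝ} (hs : 0 ≤ s) {x : ℝ} (hx : 0 ≤ x) :
    Real.log (1 + (x + s)) = Real.log (1 + s) + Real.log (1 + 1 / (1 + s) * x) := by
  rw [← Real.log_mul (by positivity) (by positivity)]
  congr 1
  field_simp
  ring

lemma integrable_log_one_add_mul {Y : Type*} [MeasurableSpace Y] {α : Measure Y} {g : Y → ℝ≥0}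
    (hg : Measurable g) (hint : Integrable (fun y => Real.log (1 + (g y : ℝ))) α)
    {c : ℝ} (hc0 : 0 ≤ c) (hc1 : c ≤ 1) :
    Integrable (fun y => Real.log (1 + c * (g y : ℝ))) α := by
  refine hint.mono' (Measurable.aestronglyMeasurable (by fun_prop)) (ae_of_all _ fun y => ?_)
  have h0 : 0 ≤ c * (g y : ℝ) := by positivity
  rw [Real.norm_of_nonneg (Real.log_nonneg (by linarith))]
  exact Real.log_le_log (by linarith) (by nlinarith [(g y).coe_nonneg])

lemma measurable_exp_neg_integral_log {Y : Type*} [MeasurableSpace Y] {α : Measure Y} [SFinite α]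
    {g : Y → ℝ≥0} (hg : Measurable g) {c : ℝ → ℝ} (hc : Measurable c) :
    Measurable fun s => ENNReal.ofReal
      (Real.exp (-∫ y, Real.log (1 + c s * (g y : ℝ)) ∂α)) := by
  have : StronglyMeasurable fun s => ∫ y, Real.log (1 + c s * (g y : ℝ)) ∂α := by
    refine StronglyMeasurable.integral_prod_right
      (f := fun s y => Real.log (1 + c s * (g y : ℝ))) (Measurable.stronglyMeasurable ?_)
    simp only [Function.uncurry_def]
    fun_prop
  have := this.measurable
  fun_prop

/-- The gamma Laplace functional at `g + s`, with the contribution of the constant `s` split off. -/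
lemma IsGammaProcessLaw.laplaceFunctional_add_const {Y : Type*} [MeasurableSpace Y]
    {G : Measure (Measure Y)} {α : Measure Y} [IsFiniteMeasure α] (hG : IsGammaProcessLaw G α)
    {g : Y → ℝ≥0} (hg : Measurable g)
    (hint : Integrable (fun y => Real.log (1 + (g y : ℝ))) α) {s : ℝ} (hs : 0 ≤ s) :
    laplaceFunctional G (fun y => g y + s.toNNReal) =
      ENNReal.ofReal ((1 + s) ^ (-α.real Set.univ)) *
        ENNReal.ofReal (Real.exp (-∫ y, Real.log (1 + 1 / (1 + s) * (g y : ℝ)) ∂α)) := by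
  have hlog : (fun y => Real.log (1 + ((g y + s.toNNReal : ℝ≥0) : ℝ))) =
      fun y => Real.log (1 + s) + Real.log (1 + 1 / (1 + s) * (g y : ℝ)) := by
    ext y
    rw [NNReal.coe_add, Real.coe_toNNReal s hs, log_one_add_add hs (g y).coe_nonneg]
  have hint' : Integrable (fun y => Real.log (1 + 1 / (1 + s) * (g y : ℝ))) α :=
    integrable_log_one_add_mul hg hint (by positivity) (by
      rw [div_le_one (by positivity)]; linarith)
  rw [hG.laplace _ (by fun_prop) (by rw [hlog]; exact (integrable_const _).add hint'), hlog,
    integral_add (integrable_const _) hint', integral_const, smul_eq_mul, neg_add, Real.exp_add,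
    ENNReal.ofReal_mul (Real.exp_nonneg _), Real.rpow_def_of_pos (by positivity)]
  ring_nf

lemma measurable_exp_neg_lintegral {Y : Type*} [MeasurableSpace Y] {f : Y → ℝ≥0∞}
    (hf : Measurable f) :
    Measurable fun μ : Measure Y => EReal.exp (-((∫⁻ y, f y ∂μ : ℝ≥0∞) : EReal)) := by
  have := Measure.measurable_lintegral hf
  fun_prop

/-- The Laplace functional of a gamma process weighted by a negative power of its total mass. -/
lemma IsGammaProcessLaw.lintegral_rpow_neg_mul_exp_neg {Y : Type*} [MeasurableSpace Y]
    {G : Measure (Measure Y)} {α : Measure Y} [IsFiniteMeasure α] (hG : IsGammaProcessLaw G α)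
    {r : ℝ} (hr : 0 < r) {g : Y → ℝ≥0} (hg : Measurable g)
    (hint : Integrable (fun y => Real.log (1 + (g y : ℝ))) α) :
    ENNReal.ofReal (Real.Gamma r) * ∫⁻ μ, (μ Set.univ) ^ (-r) *
        EReal.exp (-((∫⁻ y, (g y : ℝ≥0∞) ∂μ : ℝ≥0∞) : EReal)) ∂G =
      ∫⁻ s in Set.Ioi (0 : ℝ), ENNReal.ofReal (s ^ (r - 1) * (1 + s) ^ (-α.real Set.univ)) *
        ENNReal.ofReal (Real.exp (-∫ y, Real.log (1 + 1 / (1 + s) * (g y : ℝ)) ∂α)) := by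
  have := hG.isProbabilityMeasure
  have hE := measurable_exp_neg_lintegral (Y := Y) (f := fun y => (g y : ℝ≥0∞)) (by fun_prop)
  have hT : Measurable fun μ : Measure Y => μ Set.univ := Measure.measurable_coe .univ
  calc
    _ = ∫⁻ μ, (∫⁻ s in Set.Ioi (0 : ℝ), ENNReal.ofReal (s ^ (r - 1)) *
          EReal.exp (-((ENNReal.ofReal s * μ Set.univ : ℝ≥0∞) : EReal)) *
          EReal.exp (-((∫⁻ y, (g y : ℝ≥0∞) ∂μ : ℝ≥0∞) : EReal))) ∂G := by
      rw [← lintegral_const_mul _ ((hT.pow_const _).fun_mul hE)]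
      refine lintegral_congr fun μ => ?_
      rw [lintegral_mul_const _ (by fun_prop), lintegral_rpow_mul_exp_neg_mul hr, mul_assoc]
    _ = ∫⁻ s in Set.Ioi (0 : ℝ), ∫⁻ μ, ENNReal.ofReal (s ^ (r - 1)) *
          EReal.exp (-((ENNReal.ofReal s * μ Set.univ : ℝ≥0∞) : EReal)) *
          EReal.exp (-((∫⁻ y, (g y : ℝ≥0∞) ∂μ : ℝ≥0∞) : EReal)) ∂G := by
      refine lintegral_lintegral_swap (Measurable.aemeasurable ?_)
      simp only [Function.uncurry_def]
      have hT' : Measurable fun p : Measure Y × ℝ => p.1 Set.univ := hT.comp measurable_fst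
      refine Measurable.mul ?_ (hE.comp measurable_fst)
      fun_prop
    _ = ∫⁻ s in Set.Ioi (0 : ℝ), ENNReal.ofReal (s ^ (r - 1)) *
          laplaceFunctional G (fun y => g y + s.toNNReal) := by
      refine lintegral_congr fun s => ?_
      rw [laplaceFunctional, ← lintegral_const_mul _ (measurable_exp_neg_lintegral (by fun_prop))]
      refine lintegral_congr fun μ => ?_
      have : ∫⁻ y, ((g y + s.toNNReal : ℝ≥0) : ℝ≥0∞) ∂μ =
          ENNReal.ofReal s * μ Set.univ + ∫⁻ y, (g y : ℝ≥0∞) ∂μ := by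
        simp only [ENNReal.coe_add]
        rw [lintegral_add_right _ measurable_const, lintegral_const, add_comm]
        rfl
      rw [this, exp_neg_coe_add, mul_assoc]
    _ = _ := by
      refine setLIntegral_congr_fun measurableSet_Ioi fun s hs => ?_
      have hs' : (0 : ℝ) ≤ s := le_of_lt hs
      rw [hG.laplaceFunctional_add_const hg hint hs', ← mul_assoc,
        ENNReal.ofReal_mul (by positivity)]

/-! ### Beta and gamma-gamma distributions -/

/-- Change of variables for densities: if `p = |f'| · (d ∘ f)` on `s`, then `f` carries the measure
with density `p` on `s` to the measure with density `d` on `f '' s`. -/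
lemma map_withDensity_restrict {s : Set ℝ} {f f' : ℝ → ℝ} {p d : ℝ → ℝ≥0∞}
    (hs : MeasurableSet s) (hfm : Measurable f)
    (hf' : ∀ x ∈ s, HasDerivWithinAt f (f' x) s x) (hf : Set.InjOn f s)
    (hp : ∀ x ∈ s, p x = ENNReal.ofReal |f' x| * d (f x)) :
    ((volume.restrict s).withDensity p).map f = (volume.restrict (f '' s)).withDensity d := by
  ext t ht
  rw [Measure.map_apply hfm ht, withDensity_apply _ (hfm ht), withDensity_apply _ ht,
    ← lintegral_indicator (hfm ht), ← lintegral_indicator ht,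
    lintegral_image_eq_lintegral_abs_deriv_mul hs hf' hf]
  refine setLIntegral_congr_fun hs fun x hx => ?_
  by_cases h : f x ∈ t
  · simp [Set.indicator_of_mem, h, hp x hx]
  · simp [h]

lemma betaMeasure_eq_withDensity_restrict (a b : ℝ) :
    betaMeasure a b = (volume.restrict (Set.Ioo 0 1)).withDensity (betaPDF a b) := by
  rw [betaMeasure, ← withDensity_indicator measurableSet_Ioo]
  congr 1
  ext x
  by_cases h : x ∈ Set.Ioo (0 : ℝ) 1
  · simp [h]
  · rw [Set.indicator_of_notMem h, betaPDF_eq, if_neg (mt Set.mem_Ioo.2 h), ENNReal.ofReal_zero]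

lemma ae_betaMeasure_mem_Ioo (a b : ℝ) : ∀ᵐ u ∂betaMeasure a b, u ∈ Set.Ioo (0 : ℝ) 1 := by
  rw [betaMeasure_eq_withDensity_restrict]
  exact (withDensity_absolutelyContinuous _ _).ae_le (ae_restrict_mem measurableSet_Ioo)

lemma betaMeasure_map_div_one_sub (a b : ℝ) :
    (betaMeasure a b).map (fun u => u / (1 - u)) = gammaGammaMeasure (a + b) a := by
  have himg : (fun u : ℝ => u / (1 - u)) '' Set.Ioo 0 1 = Set.Ioi 0 := by
    ext v
    constructor
    · rintro ⟨u, ⟨h0, h1⟩, rfl⟩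
      exact div_pos h0 (sub_pos.2 h1)
    · intro (hv : 0 < v)
      refine ⟨v / (1 + v), ⟨by positivity, (div_lt_one (by positivity)).2 (by linarith)⟩, ?_⟩
      have : 1 - v / (1 + v) = 1 / (1 + v) := by field_simp; ring
      simp only [this]
      field_simp
  rw [betaMeasure_eq_withDensity_restrict, gammaGammaMeasure, ← himg]
  refine map_withDensity_restrict (f' := fun u => 1 / (1 - u) ^ 2) measurableSet_Ioo
    (by fun_prop) (fun u hu => ?_) (fun u hu w hw h => ?_) (fun u hu => ?_)
  · have h1 : (1 : ℝ) - u ≠ 0 := (sub_pos.2 hu.2).ne'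
    refine (((hasDerivAt_id u).div ((hasDerivAt_const u (1 : ℝ)).sub (hasDerivAt_id u))
      h1).congr_deriv ?_).hasDerivWithinAt
    simp
  · have h1 : (1 : ℝ) - u ≠ 0 := (sub_pos.2 hu.2).ne'
    have h2 : (1 : ℝ) - w ≠ 0 := (sub_pos.2 hw.2).ne'
    simp only [div_eq_div_iff h1 h2] at h
    linarith
  · have h1 : 0 < 1 - u := sub_pos.2 hu.2
    rw [betaPDF_of_pos_lt_one hu.1 hu.2, ← ENNReal.ofReal_mul (abs_nonneg _),
      abs_of_nonneg (by positivity)]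
    congr 1
    have h2 : 1 + u / (1 - u) = (1 - u)⁻¹ := by field_simp; ring
    have h3 : (1 - u) ^ (b - 1) =
        1 / (1 - u) ^ 2 * (((1 - u) ^ (a - 1))⁻¹ * (1 - u) ^ (a + b)) := by
      rw [← Real.rpow_neg h1.le, ← Real.rpow_add h1, one_div, ← Real.rpow_natCast,
        ← Real.rpow_neg h1.le, ← Real.rpow_add h1]
      congr 1
      push_cast
      ring
    rw [h2, Real.div_rpow hu.1.le h1.le, Real.inv_rpow h1.le, Real.rpow_neg h1.le (a + b), inv_inv,
      h3, beta, add_sub_cancel_left, one_div_div]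
    ring

/-- Beta distributions are exchanged by the reflection `u ↦ 1 - u`. -/
lemma betaMeasure_map_one_sub (a b : ℝ) :
    (betaMeasure a b).map (fun u => 1 - u) = betaMeasure b a := by
  have himg : (fun u : ℝ => 1 - u) '' Set.Ioo 0 1 = Set.Ioo 0 1 := by
    simp
  rw [betaMeasure_eq_withDensity_restrict, betaMeasure_eq_withDensity_restrict b a]
  conv_rhs => rw [← himg]
  refine map_withDensity_restrict (f' := fun _ => -1) measurableSet_Ioo
    (by fun_prop) (fun u _ => ((hasDerivAt_id u).const_sub 1).hasDerivWithinAt)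
    (fun u _ w _ h => by simpa using h) (fun u hu => ?_)
  rw [betaPDF_of_pos_lt_one hu.1 hu.2,
    betaPDF_of_pos_lt_one (sub_pos.2 hu.2) (by linarith [hu.1]), beta, beta, add_comm b a,
    mul_comm (Real.Gamma b)]
  simp only [abs_neg, abs_one, ENNReal.ofReal_one, one_mul, sub_sub_cancel]
  congr 1
  ring

lemma betaMeasure_map_one_sub_div (a b : ℝ) :
    (betaMeasure a b).map (fun u => (1 - u) / u) = gammaGammaMeasure (a + b) b := by
  rw [add_comm, ← betaMeasure_map_div_one_sub, ← betaMeasure_map_one_sub,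
    Measure.map_map (by fun_prop) (by fun_prop)]
  congr 1
  ext u
  simp

/-! ### The Laplace functional of the beta-gamma process -/

/-- The gamma-gamma mixture with parameters `θ` and `θ - q`, which is the form that integrating
over `s` gives directly: `v` is the variable `s` of the gamma integral for `T ^ (-(θ - q))`. -/
lemma IsBetaGammaProcessLaw.laplaceFunctional_eq {Y : Type*} [MeasurableSpace Y]
    {H : Measure Y} [IsProbabilityMeasure H] {θ q : ℝ} (hq : 0 < q) (hθ : q < θ)
    {B : Measure (Measure Y)} (hB : IsBetaGammaProcessLaw B H θ q)
    {g : Y → ℝ≥0} (hg : Measurable g)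
    (hint : Integrable (fun y => Real.log (1 + (g y : ℝ))) (ENNReal.ofReal θ • H)) :
    laplaceFunctional B g = ∫⁻ v, ENNReal.ofReal
      (Real.exp (-∫ y, Real.log (1 + 1 / (1 + v) * (g y : ℝ)) ∂(ENNReal.ofReal θ • H)))
      ∂(gammaGammaMeasure θ (θ - q)) := by
  obtain ⟨G, hG, rfl⟩ := hB
  have hfin : IsFiniteMeasure (ENNReal.ofReal θ • H) := Measure.smul_finite _ ENNReal.ofReal_ne_top
  have hr : 0 < θ - q := sub_pos.2 hθ
  have hmass : (ENNReal.ofReal θ • H).real Set.univ = θ := by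
    simp [(hq.trans hθ).le]
  have hΓ := Real.Gamma_pos_of_pos hr
  have hΓq := Real.Gamma_pos_of_pos hq
  have hΓθ := Real.Gamma_pos_of_pos (hq.trans hθ)
  have hT : Measurable fun μ : Measure Y => μ Set.univ := Measure.measurable_coe .univ
  have hE := measurable_exp_neg_lintegral (Y := Y) (f := fun y => (g y : ℝ≥0∞)) (by fun_prop)
  have hF := measurable_exp_neg_integral_log (α := ENNReal.ofReal θ • H) hg
    (c := fun s => 1 / (1 + s)) (by fun_prop)
  have key := hG.lintegral_rpow_neg_mul_exp_neg hr hg hint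
  rw [hmass] at key
  have hconst : ENNReal.ofReal (Real.Gamma θ / Real.Gamma q) =
      ENNReal.ofReal (Real.Gamma θ / (Real.Gamma (θ - q) * Real.Gamma q)) *
        ENNReal.ofReal (Real.Gamma (θ - q)) := by
    rw [← ENNReal.ofReal_mul (by positivity)]
    congr 1
    field_simp
  rw [laplaceFunctional, lintegral_smul_measure, smul_eq_mul,
    lintegral_withDensity_eq_lintegral_mul _ (hT.pow_const _) hE]
  simp only [Pi.mul_apply]
  rw [hconst, mul_assoc, key, gammaGammaMeasure,
    lintegral_withDensity_eq_lintegral_mul _ (by fun_prop) hF,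
    ← lintegral_const_mul _ (by fun_prop)]
  refine lintegral_congr fun v => ?_
  rw [Pi.mul_apply, sub_sub_cancel, ← mul_assoc, ← ENNReal.ofReal_mul (by positivity), ← mul_assoc]

theorem proposition3p1 {Y : Type*} [TopologicalSpace Y] [PolishSpace Y] [MeasurableSpace Y]
    [BorelSpace Y] (H : Measure Y) [IsProbabilityMeasure H] (θ q : ℝ) (hq : 0 < q) (hθ : q < θ)
    (B : Measure (Measure Y)) (hB : IsBetaGammaProcessLaw B H θ q) :
    -- the Laplace functional in its beta form and in its two gamma-gamma forms
    (∀ g : Y → ℝ≥0, Measurable g →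
      Integrable (fun y => Real.log (1 + (g y : ℝ))) (ENNReal.ofReal θ • H) →
      laplaceFunctional B g =
          ∫⁻ u, ENNReal.ofReal
            (Real.exp (-∫ y, Real.log (1 + u * (g y : ℝ)) ∂(ENNReal.ofReal θ • H)))
            ∂(betaMeasure q (θ - q)) ∧
      laplaceFunctional B g =
          ∫⁻ v, ENNReal.ofReal
            (Real.exp (-∫ y, Real.log (1 + v / (1 + v) * (g y : ℝ)) ∂(ENNReal.ofReal θ • H)))
            ∂(gammaGammaMeasure θ q) ∧
      laplaceFunctional B g =
          ∫⁻ v, ENNReal.ofReal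
            (Real.exp (-∫ y, Real.log (1 + 1 / (1 + v) * (g y : ℝ)) ∂(ENNReal.ofReal θ • H)))
            ∂(gammaGammaMeasure θ (θ - q))) ∧
    -- the changes of variable v = u / (1 - u) and v = (1 - u) / u behind the last two
    (betaMeasure q (θ - q)).map (fun u => u / (1 - u)) = gammaGammaMeasure θ q ∧
    (betaMeasure q (θ - q)).map (fun u => (1 - u) / u) = gammaGammaMeasure θ (θ - q) := by
  have hmap₁ := betaMeasure_map_div_one_sub q (θ - q)
  have hmap₂ := betaMeasure_map_one_sub_div q (θ - q)
  rw [add_sub_cancel] at hmap₁ hmap₂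
  refine ⟨fun g hg hint => ?_, hmap₁, hmap₂⟩
  have hfin : IsFiniteMeasure (ENNReal.ofReal θ • H) := Measure.smul_finite _ ENNReal.ofReal_ne_top
  have h₃ := hB.laplaceFunctional_eq hq hθ hg hint
  have h₁ : laplaceFunctional B g = ∫⁻ u, ENNReal.ofReal
      (Real.exp (-∫ y, Real.log (1 + u * (g y : ℝ)) ∂(ENNReal.ofReal θ • H)))
      ∂(betaMeasure q (θ - q)) := by
    rw [h₃, ← hmap₂, lintegral_map
      (measurable_exp_neg_integral_log hg (c := fun s => 1 / (1 + s)) (by fun_prop))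
      (by fun_prop)]
    refine lintegral_congr_ae ?_
    filter_upwards [ae_betaMeasure_mem_Ioo q (θ - q)] with u hu
    have hu0 : u ≠ 0 := hu.1.ne'
    have : 1 / (1 + (1 - u) / u) = u := by field_simp; ring
    rw [this]
  refine ⟨h₁, ?_, h₃⟩
  rw [h₁, ← hmap₁, lintegral_map
    (measurable_exp_neg_integral_log hg (c := fun s => s / (1 + s)) (by fun_prop)) (by fun_prop)]
  refine lintegral_congr_ae ?_
  filter_upwards [ae_betaMeasure_mem_Ioo q (θ - q)] with u hu
  have hu1 : 1 - u ≠ 0 := (sub_pos.2 hu.2).ne'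
  have : u / (1 - u) / (1 + u / (1 - u)) = u := by field_simp; ring
  rw [this]
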